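/- Let $\alpha\in(0,\pi]$ and $\theta\in(0,\pi/2]$ with $(\alpha,\theta)\neq(\pi,\pi/2)$ and $\alpha/\pi$ rational. Let $n_\alpha$ be the smallest positive integer $n$ such that $n\alpha$ is an integer multiple of $2\pi$, and let $z_k(\alpha,\theta)=\cos^2\theta+\sin^2\theta\cos(k\alpha)$. A completely positive superoperator (CPSO) for one qubit is a $\mathbb{C}$-linear map $G:\mathbb{C}^{2\times 2}\to\mathbb{C}^{2\times 2}$ that sends density matrices (positive semidefinite Hermitian matrices of trace $1$) to density matrices, and such that $G\otimes I_M$ also sends density matrices to density matrices for every positive integer $M$, where $I_M$ is the identity map on $\mathbb{C}^{M\times M}$. For a density matrix $\rho$ put $\mathrm{Pr}^0(\rho)=\langle 0|\rho|0\rangle$. An experimental equation is an equation $\mathrm{Pr}^0(G^k(|b\rangle\langle b|))=r$ in a CPSO variable $G$, where $k\ge 0$ is an integer, $b\in\{0,1\}$ and $0\le r\le 1$. A finite set of experimental equations characterizes a family $\mathcal{F}$ of CPSOs for one qubit if $\mathcal{F}$ is exactly the set of all CPSOs for one qubit that satisfy all of the equations. For real $\alpha'$ and $\phi$, let $R_{\alpha',\theta,\phi}$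 be the unitary transformation of $\mathbb{C}^2$ that fixes $\cos(\theta/2)|0\rangle+e^{i\phi}\sin(\theta/2)|1\rangle$ and multiplies $\sin(\theta/2)|0\rangle-e^{i\phi}\cos(\theta/2)|1\rangle$ by $e^{i\alpha'}$, and let $\mathbf{R}_{\alpha',\theta,\phi}$ be the CPSO $\rho\mapsto R_{\alpha',\theta,\phi}\,\rho\,R_{\alpha',\theta,\phi}^\dagger$. Let $\mathcal{R}_{\alpha,\theta}=\{\mathbf{R}_{\alpha,\theta,\phi},\mathbf{R}_{-\alpha,\theta,\phi}:\phi\in[0,2\pi)\}$. Then the following finite set of experimental equations characterizes $\mathcal{R}_{\alpha,\theta}$: $$\mathrm{Pr}^0\bigl(G^{n_\alpha}(|1\rangle\langle 1|)\bigr)=0,\qquad \mathrm{Pr}^0\bigl(G^{k}(|0\rangle\langle 0|)\bigr)=\tfrac12+\tfrac12 z_k(\alpha,\theta)\quad\text{for } k=1,\dots,n_\alpha.$$ -/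

import Mathlib

open scoped Matrix ComplexOrder Kronecker

noncomputable section

namespace SelfTest

/-- A density matrix: a Hermitian positive semidefinite complex matrix of trace `1`. -/
def IsDensity {ι : Type*} [Fintype ι] (ρ : Matrix ι ι ℂ) : Prop :=
  ρ.PosSemidef ∧ ρ.trace = 1

/-- Superoperators: linear transformations of a space of square complex matrices. -/
abbrev Superop (ι : Type*) := Module.End ℂ (Matrix ι ι ℂ)

/-- A positive superoperator sends density matrices to density matrices. -/
def IsPSO {ι : Type*} [Fintype ι] (G : Superop ι) : Prop :=
  ∀ ρ : Matrix ι ι ℂ, IsDensity ρ → IsDensity (G ρ)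

/-- The superoperator `G ⊗ I` on `ι × κ`: apply `G` to each of the blocks
`(V (i, a) (j, b))` for `i, j : ι`, where `a, b : κ` are fixed. -/
def tensorId {ι : Type*} (κ : Type*) (G : Superop ι) : Superop (ι × κ) where
  toFun V := Matrix.of fun p q =>
    G (Matrix.of fun i j => V (i, p.2) (j, q.2)) p.1 q.1
  map_add' V W := by
    ext p q
    exact congrFun (congrFun (map_add G (Matrix.of fun i j => V (i, p.2) (j, q.2))
      (Matrix.of fun i j => W (i, p.2) (j, q.2))) p.1) q.1
  map_smul' c V := by
    ext p q
    exact congrFun (congrFun (map_smul G c (Matrix.of fun i j => V (i, p.2) (j, q.2))) p.1) q.1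

/-- `tensorId κ G` is the tensor product of `G` with the identity. -/
theorem tensorId_kronecker {ι κ : Type*} (G : Superop ι) (A : Matrix ι ι ℂ)
    (B : Matrix κ κ ℂ) : tensorId κ G (A ⊗ₖ B) = G A ⊗ₖ B := by
  ext p q
  have h : (Matrix.of fun i j => (A ⊗ₖ B) (i, p.2) (j, q.2)) = B p.2 q.2 • A := by
    ext i j
    simp [mul_comm]
  change G (Matrix.of fun i j => (A ⊗ₖ B) (i, p.2) (j, q.2)) p.1 q.1 = _
  rw [h, map_smul]
  simp [mul_comm]

/-- A completely positive superoperator (CPSO): `G` is positive, and so is `G ⊗ I_M` for every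
positive integer `M`. -/
def IsCPSO {ι : Type*} [Fintype ι] (G : Superop ι) : Prop :=
  IsPSO G ∧ ∀ M : ℕ, 0 < M → IsPSO (tensorId (Fin M) G)

/-- The superoperator `ρ ↦ A ρ A†`. -/
def conjBy {ι : Type*} [Fintype ι] (A : Matrix ι ι ℂ) : Superop ι where
  toFun ρ := A * ρ * Aᴴ
  map_add' ρ σ := by rw [mul_add, add_mul]
  map_smul' c ρ := by simp

/-- `|b⟩⟨b|` for a classical state `b` of one qubit. -/
def ketbra (b : Fin 2) : Matrix (Fin 2) (Fin 2) ℂ := Matrix.single b b 1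

/-- The probability `⟨0|ρ|0⟩` of measuring `|0⟩⟨0|` (a real number when `ρ` is Hermitian). -/
def Pr0 (ρ : Matrix (Fin 2) (Fin 2) ℂ) : ℝ := (ρ 0 0).re

/-- `|ψ⟩ = cos(θ/2)|0⟩ + e^{iφ} sin(θ/2)|1⟩`. -/
def psi (θ φ : ℝ) : Fin 2 → ℂ :=
  ![(Real.cos (θ / 2) : ℂ), Complex.exp (φ * Complex.I) * (Real.sin (θ / 2) : ℂ)]

/-- `|ψ^⊥⟩ = sin(θ/2)|0⟩ - e^{iφ} cos(θ/2)|1⟩`. -/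
def psiPerp (θ φ : ℝ) : Fin 2 → ℂ :=
  ![(Real.sin (θ / 2) : ℂ), -(Complex.exp (φ * Complex.I) * (Real.cos (θ / 2) : ℂ))]

/-- The unitary matrix `R_{α,θ,φ} = |ψ⟩⟨ψ| + e^{iα} |ψ^⊥⟩⟨ψ^⊥|`. -/
def rot (α θ φ : ℝ) : Matrix (Fin 2) (Fin 2) ℂ :=
  Matrix.vecMulVec (psi θ φ) (star (psi θ φ)) +
    Complex.exp (α * Complex.I) • Matrix.vecMulVec (psiPerp θ φ) (star (psiPerp θ φ))

/-- The family `{R_{±α,θ,φ} : φ ∈ [0, 2π)}` of unitary superoperators. -/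
def rotFamily (α θ : ℝ) : Set (Superop (Fin 2)) :=
  {G | ∃ φ ∈ Set.Ico (0 : ℝ) (2 * Real.pi),
    G = conjBy (rot α θ φ) ∨ G = conjBy (rot (-α) θ φ)}

/-- An experimental equation `Pr0 (G^k (|b⟩⟨b|)) = r` in one variable `G`. -/
structure ExpEq where
  /-- the number `k` of iterations, called the size of the equation -/
  size : ℕ
  /-- the initial classical state `b` -/
  bit : Fin 2
  /-- the constant term `r` -/
  const : ℝ
  const_mem : const ∈ Set.Icc (0 : ℝ) 1

/-- `G` satisfies the experimental equation `e`. -/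
def ExpEq.Holds (e : ExpEq) (G : Superop (Fin 2)) : Prop :=
  Pr0 ((G ^ e.size) (ketbra e.bit)) = e.const

/-- The family of all one-qubit CPSOs that satisfy every equation of `E`. -/
def solutions (E : Set ExpEq) : Set (Superop (Fin 2)) :=
  {G | IsCPSO G ∧ ∀ e ∈ E, e.Holds G}

/-- A finite set `E` of experimental equations characterizes the family `F`. -/
def Characterizes (E : Set ExpEq) (F : Set (Superop (Fin 2))) : Prop :=
  E.Finite ∧ F = solutions E

/-- The smallest positive integer `n` such that `n α` is a multiple of `2π`
(it exists when `α / π` is rational). -/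
def period (α : ℝ) : ℕ :=
  sInf {n : ℕ | 0 < n ∧ ∃ m : ℤ, (n : ℝ) * α = m * (2 * Real.pi)}

/-- `z_k(α,θ) = cos² θ + sin² θ cos(kα)`. -/
def zCoord (k : ℕ) (α θ : ℝ) : ℝ :=
  Real.cos θ ^ 2 + Real.sin θ ^ 2 * Real.cos (k * α)

theorem zCoord_const_mem (k : ℕ) (α θ : ℝ) :
    1 / 2 + 1 / 2 * zCoord k α θ ∈ Set.Icc (0 : ℝ) 1 := by
  have h1 := Real.sin_sq_add_cos_sq θ
  have h2 := Real.cos_le_one (k * α)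
  have h3 := Real.neg_one_le_cos (k * α)
  unfold zCoord
  constructor <;> nlinarith [sq_nonneg (Real.sin θ), sq_nonneg (Real.cos θ)]

/-- The equation `Pr0 (G^n (|1⟩⟨1|)) = 0`. -/
def eqOne (n : ℕ) : ExpEq := ⟨n, 1, 0, by simp⟩

/-- The equation `Pr0 (G^k (|0⟩⟨0|)) = 1/2 + 1/2 z_k(α,θ)`. -/
def eqZero (k : ℕ) (α θ : ℝ) : ExpEq :=
  ⟨k, 0, 1 / 2 + 1 / 2 * zCoord k α θ, zCoord_const_mem k α θ⟩

/-- The equations `Pr0 (G^{n_α} (|1⟩⟨1|)) = 0` and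
`Pr0 (G^k (|0⟩⟨0|)) = 1/2 + 1/2 z_k(α,θ)` for `k = 1, …, n_α`. -/
def rotEquations (α θ : ℝ) : Set ExpEq :=
  {eqOne (period α)} ∪ {e | ∃ k ∈ Set.Icc 1 (period α), e = eqZero k α θ}

end SelfTest

end

/-!
The easy inclusion is a computation with `rot α θ φ ^ k = rot (k * α) θ φ`, which is the identity for
`k = n_α`.

For the converse let `G` be a CPSO that satisfies the equations. Since `z_{n_α} = 1`, the power
`G ^ n_α` fixes both `|0⟩⟨0|` and `|1⟩⟨1|`. A CPSO cannot make two states more distinguishable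
(`IsCPSO.mul_eq_zero_of_distinguishes`), so `G ^ k` maps them to orthogonal, hence pure, states for
every `k ≤ n_α`; only `k = 1, 2` are needed, and `n_α ≥ 2` because `0 < α ≤ π`. After a unitary
change of basis in the target, `G` fixes the two classical states, and complete positivity makes it a
dephasing map with some constant `c` (`IsCPSO.exists_dephasing`). The state `G (|0⟩⟨0|)` is not
classical, since `-1 < z_1 < 1` when `(α, θ) ≠ (π, π/2)`; its image under `G` is pure again, which
forces `|c| = 1`. So `G` is conjugation by a matrix in `SU(2)` (`IsCPSO.exists_su_of_pow`).

Write the first column of that matrix as `(a, b)`. The equations for `k = 1` and `k = 2` say that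
`|b|² = sin² θ sin² (α/2)` and `(Re a)² = cos² (α/2)`. As `Re a ≥ 0` may be assumed, this leaves free
only the sign of `Im a`, which is the sign of the rotation angle `±α`, and the phase of `b`, which
is `φ` (`conjBy_su_mem_rotFamily`).
-/

namespace SelfTest

open Matrix

/-! ### Positive semidefinite matrices -/

/-- With `A = C†C` and `B = D†D`, the trace of `AB` is the squared Hilbert–Schmidt norm of
`CD†`. -/
theorem mul_eq_zero_of_trace_mul_eq_zero {ι : Type*} [Fintype ι] [DecidableEq ι]
    {A B : Matrix ι ι ℂ} (hA : A.PosSemidef) (hB : B.PosSemidef) (h : (A * B).trace = 0) :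
    A * B = 0 := by
  obtain ⟨C, rfl⟩ : ∃ C : Matrix ι ι ℂ, A = Cᴴ * C := by
    open scoped MatrixOrder in
    exact CStarAlgebra.nonneg_iff_eq_star_mul_self.mp hA.nonneg
  obtain ⟨D, rfl⟩ : ∃ D : Matrix ι ι ℂ, B = Dᴴ * D := by
    open scoped MatrixOrder in
    exact CStarAlgebra.nonneg_iff_eq_star_mul_self.mp hB.nonneg
  have h0 : C * Dᴴ = 0 := by
    rw [← trace_conjTranspose_mul_self_eq_zero_iff, ← h, conjTranspose_mul,
      conjTranspose_conjTranspose, Matrix.mul_assoc, trace_mul_comm]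
    simp only [Matrix.mul_assoc]
  calc Cᴴ * C * (Dᴴ * D) = Cᴴ * (C * Dᴴ) * D := by simp only [Matrix.mul_assoc]
    _ = 0 := by simp [h0]

/-- A vanishing diagonal entry of a positive semidefinite matrix kills its whole column. -/
theorem apply_eq_zero_of_diag_eq_zero {ι : Type*} [Fintype ι] [DecidableEq ι] {A : Matrix ι ι ℂ}
    (hA : A.PosSemidef) {j : ι} (h : A j j = 0) (i : ι) : A i j = 0 := by
  have hs : (single j j (1 : ℂ)).PosSemidef := by
    have := posSemidef_vecMulVec_self_star (Pi.single j (1 : ℂ))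
    convert this using 1
    ext k l
    simp [vecMulVec_apply, single_apply, Pi.single_apply]
    grind
  have := mul_eq_zero_of_trace_mul_eq_zero hA hs (by simp [trace_mul_single, h])
  simpa using congrFun (congrFun this i) j

/-! ### Composition of superoperators and unitary conjugation -/

section General

variable {ι κ : Type*}

theorem tensorId_mul (G H : Superop ι) :
    tensorId κ (G * H) = tensorId κ G * tensorId κ H := rfl

variable [Fintype ι]

theorem IsPSO.mul {G H : Superop ι} (hG : IsPSO G) (hH : IsPSO H) : IsPSO (G * H) :=
  fun ρ hρ => hG _ (hH ρ hρ)

theorem IsCPSO.mul {G H : Superop ι} (hG : IsCPSO G) (hH : IsCPSO H) : IsCPSO (G * H) :=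
  ⟨hG.1.mul hH.1, fun M hM => by
    rw [tensorId_mul]
    exact (hG.2 M hM).mul (hH.2 M hM)⟩

theorem isCPSO_one : IsCPSO (1 : Superop ι) :=
  ⟨fun _ h => h, fun _ _ _ h => h⟩

theorem IsCPSO.pow {G : Superop ι} (hG : IsCPSO G) (k : ℕ) : IsCPSO (G ^ k) := by
  induction k with
  | zero => exact isCPSO_one
  | succ k ih =>
    rw [pow_succ]
    exact ih.mul hG

theorem conjBy_apply (A ρ : Matrix ι ι ℂ) : conjBy A ρ = A * ρ * Aᴴ := rfl

theorem conjBy_mul (A B : Matrix ι ι ℂ) : conjBy (A * B) = conjBy A * conjBy B := by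
  ext1 ρ
  simp only [conjBy_apply, conjTranspose_mul, Matrix.mul_assoc, Module.End.mul_apply]

/-- A global phase is invisible to conjugation. -/
theorem conjBy_smul {c : ℂ} (hc : c * star c = 1) (A : Matrix ι ι ℂ) :
    conjBy (c • A) = conjBy A := by
  ext1 ρ
  simp only [conjBy_apply, conjTranspose_smul, smul_mul, Matrix.mul_smul, smul_smul]
  rw [mul_comm (star c), hc, one_smul]

theorem tensorId_conjBy [Fintype κ] [DecidableEq κ] (U : Matrix ι ι ℂ) :
    tensorId κ (conjBy U) = conjBy (U ⊗ₖ (1 : Matrix κ κ ℂ)) := by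
  ext1 V
  ext ⟨i, a⟩ ⟨j, b⟩
  simp [tensorId, conjBy_apply, Matrix.mul_apply, Fintype.sum_prod_type, Matrix.one_apply,
    apply_ite, Finset.sum_ite_eq]

variable [DecidableEq ι]

theorem conjBy_one : conjBy (1 : Matrix ι ι ℂ) = 1 := by
  ext1 ρ
  simp [conjBy_apply]

theorem conjBy_pow (A : Matrix ι ι ℂ) (k : ℕ) : conjBy A ^ k = conjBy (A ^ k) := by
  induction k with
  | zero => simp [conjBy_one]
  | succ k ih => rw [pow_succ, pow_succ, ih, conjBy_mul]

theorem isPSO_conjBy {U : Matrix ι ι ℂ} (hU : Uᴴ * U = 1) : IsPSO (conjBy U) := by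
  intro ρ hρ
  refine ⟨hρ.1.mul_mul_conjTranspose_same U, ?_⟩
  rw [conjBy_apply, trace_mul_comm, ← Matrix.mul_assoc, hU, Matrix.one_mul, hρ.2]

theorem isCPSO_conjBy {U : Matrix ι ι ℂ} (hU : Uᴴ * U = 1) : IsCPSO (conjBy U) := by
  refine ⟨isPSO_conjBy hU, fun M _ => ?_⟩
  rw [tensorId_conjBy]
  apply isPSO_conjBy
  rw [conjTranspose_kronecker, ← mul_kronecker_mul, hU]
  simp

end General

/-! ### One-qubit superoperators: trace, Choi matrix and effects -/

theorem isDensity_ketbra (b : Fin 2) : IsDensity (ketbra b) := by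
  refine ⟨?_, by simp [ketbra]⟩
  have := posSemidef_vecMulVec_self_star (Pi.single b (1 : ℂ))
  convert this using 1
  ext i j
  fin_cases b <;> fin_cases i <;> fin_cases j <;> simp [ketbra, vecMulVec_apply]

/-- A positive superoperator preserves the trace of every matrix, as the density matrices span. -/
theorem IsPSO.trace_map {G : Superop (Fin 2)} (hG : IsPSO G) (X : Matrix (Fin 2) (Fin 2) ℂ) :
    (G X).trace = X.trace := by
  have key : ∀ v : Fin 2 → ℂ, star v ⬝ᵥ v = 2 →
      (G (vecMulVec v (star v))).trace = 2 := by
    intro v hv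
    have hd : IsDensity ((1 / 2 : ℂ) • vecMulVec v (star v)) := by
      refine ⟨(posSemidef_vecMulVec_self_star v).smul ?_, ?_⟩
      · norm_num [Complex.le_def]
      · rw [trace_smul, trace_vecMulVec, dotProduct_comm, hv]
        norm_num
    have := (hG _ hd).2
    rw [map_smul, trace_smul, smul_eq_mul] at this
    linear_combination 2 * this
  have h0 := (hG _ (isDensity_ketbra 0)).2
  have h1 := (hG _ (isDensity_ketbra 1)).2
  -- the states `|+⟩` and `|+i⟩` account for the off-diagonal matrix units
  have hx := key ![1, 1] (by simp [dotProduct, Fin.sum_univ_two]; norm_num)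
  have hy := key ![1, Complex.I] (by simp [dotProduct, Fin.sum_univ_two]; norm_num)
  have ex : vecMulVec ![1, 1] (star ![(1 : ℂ), 1]) =
      ketbra 0 + ketbra 1 + (single 0 1 1 + single 1 0 1) := by
    ext i j
    fin_cases i <;> fin_cases j <;> simp [ketbra, vecMulVec_apply]
  have ey : vecMulVec ![1, Complex.I] (star ![(1 : ℂ), Complex.I]) =
      ketbra 0 + ketbra 1 + (-Complex.I • single 0 1 1 + Complex.I • single 1 0 1) := by
    ext i j
    fin_cases i <;> fin_cases j <;> simp [ketbra, vecMulVec_apply]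
  have eX : X = X 0 0 • ketbra 0 + X 1 1 • ketbra 1 + X 0 1 • single 0 1 1 +
      X 1 0 • single 1 0 1 := by
    ext i j
    fin_cases i <;> fin_cases j <;> simp [ketbra]
  rw [ex] at hx
  rw [ey] at hy
  simp only [map_add, trace_add, map_smul, trace_smul, h0, h1, smul_eq_mul, neg_smul, map_neg,
    trace_neg] at hx hy
  have h01 : (G (single 0 1 1)).trace = 0 := by
    linear_combination (1 / 2) * hx + (Complex.I / 2) * hy +
      (1 / 2) * ((G (single 0 1 1)).trace - (G (single 1 0 1)).trace) * Complex.I_sq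
  have h10 : (G (single 1 0 1)).trace = 0 := by linear_combination hx - h01
  conv_lhs => rw [eX]
  simp only [map_add, trace_add, map_smul, trace_smul, h0, h1, h01, h10, smul_eq_mul,
    trace_fin_two]
  ring

/-- The Choi matrix of `G`: its entry at `(i, a), (j, b)` is the entry `i j` of `G (|a⟩⟨b|)`. It is
`G ⊗ I` applied to the unnormalized maximally entangled state `∑ |aa⟩⟨bb|`. -/
def choi (G : Superop (Fin 2)) : Matrix (Fin 2 × Fin 2) (Fin 2 × Fin 2) ℂ :=
  of fun p q => G (single p.2 q.2 1) p.1 q.1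

theorem IsCPSO.posSemidef_choi {G : Superop (Fin 2)} (hG : IsCPSO G) : (choi G).PosSemidef := by
  let v : Fin 2 × Fin 2 → ℂ := fun p => if p.1 = p.2 then 1 else 0
  have hd : IsDensity ((1 / 2 : ℂ) • vecMulVec v (star v)) := by
    refine ⟨(posSemidef_vecMulVec_self_star v).smul ?_, ?_⟩
    · norm_num [Complex.le_def]
    · rw [trace_smul, trace_vecMulVec]
      simp [v, dotProduct, Fintype.sum_prod_type]
  have h := (hG.2 2 two_pos _ hd).1.smul (show (0 : ℂ) ≤ 2 by norm_num [Complex.le_def])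
  suffices e : choi G = (2 : ℂ) • tensorId (Fin 2) G ((1 / 2 : ℂ) • vecMulVec v (star v)) by
    rw [e]; exact h
  rw [map_smul, smul_smul, show (2 : ℂ) * (1 / 2) = 1 by norm_num, one_smul]
  ext ⟨i, a⟩ ⟨j, b⟩
  change G _ i j = G _ i j
  refine congrFun (congrFun (congrArg G ?_) i) j
  ext k l
  fin_cases a <;> fin_cases b <;> fin_cases k <;> fin_cases l <;>
    simp [v, vecMulVec_apply]

/-- The matrix `F` with `tr (F ρ) = ⟨i|G ρ|i⟩` for all `ρ`. The indices of `G (|b⟩⟨a|)` are swapped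
because `F` is paired with `ρ` by the trace. -/
def effect (G : Superop (Fin 2)) (i : Fin 2) : Matrix (Fin 2) (Fin 2) ℂ :=
  of fun a b => G (single b a 1) i i

/-- `effect G i` describes the measurement of outcome `i` after `G` in the Heisenberg picture. -/
theorem trace_effect_mul (G : Superop (Fin 2)) (i : Fin 2) (ρ : Matrix (Fin 2) (Fin 2) ℂ) :
    (effect G i * ρ).trace = G ρ i i := by
  have eρ : ρ = ρ 0 0 • single 0 0 1 + ρ 1 1 • single 1 1 1 + ρ 0 1 • single 0 1 1 +
      ρ 1 0 • single 1 0 1 := by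
    ext i j
    fin_cases i <;> fin_cases j <;> simp
  conv_rhs => rw [eρ]
  simp [map_add, trace_fin_two, Matrix.mul_apply, effect, Fin.sum_univ_two, -smul_single]
  ring

theorem IsCPSO.posSemidef_effect {G : Superop (Fin 2)} (hG : IsCPSO G) (i : Fin 2) :
    (effect G i).PosSemidef :=
  (hG.posSemidef_choi.submatrix fun a => (i, a)).transpose

theorem IsPSO.effect_add {G : Superop (Fin 2)} (hG : IsPSO G) : effect G 0 + effect G 1 = 1 := by
  ext a b
  have := hG.trace_map (single b a 1)
  rw [trace_fin_two] at this
  change G _ 0 0 + G _ 1 1 = _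
  rw [this]
  fin_cases a <;> fin_cases b <;> simp

/-- If a CPSO sends `ρ₀` to a multiple of `|0⟩⟨0|` and `ρ₁` to a multiple of `|1⟩⟨1|`, then `ρ₀` and
`ρ₁` are orthogonal: `effect G 0` acts as `1` on the range of `ρ₀` and as `0` on that of `ρ₁`. -/
theorem IsCPSO.mul_eq_zero_of_distinguishes {G : Superop (Fin 2)} (hG : IsCPSO G)
    {ρ₀ ρ₁ : Matrix (Fin 2) (Fin 2) ℂ} (h₀ : ρ₀.PosSemidef) (h₁ : ρ₁.PosSemidef)
    (e₀ : G ρ₀ 1 1 = 0) (e₁ : G ρ₁ 0 0 = 0) : ρ₁ * ρ₀ = 0 := by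
  have z₀ := mul_eq_zero_of_trace_mul_eq_zero (hG.posSemidef_effect 1) h₀
    (by rw [trace_effect_mul, e₀])
  have z₁ := mul_eq_zero_of_trace_mul_eq_zero (hG.posSemidef_effect 0) h₁
    (by rw [trace_effect_mul, e₁])
  have z₁' : ρ₁ * effect G 0 = 0 := by
    have := congrArg conjTranspose z₁
    rwa [conjTranspose_mul, h₁.1.eq, (hG.posSemidef_effect 0).1.eq, conjTranspose_zero] at this
  calc ρ₁ * ρ₀ = ρ₁ * (effect G 0 + effect G 1) * ρ₀ := by rw [hG.1.effect_add, Matrix.mul_one]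
    _ = ρ₁ * effect G 0 * ρ₀ + ρ₁ * (effect G 1 * ρ₀) := by
      rw [Matrix.mul_add, Matrix.add_mul, Matrix.mul_assoc ρ₁ (effect G 1)]
    _ = 0 := by rw [z₁', z₀]; simp

theorem det_eq_zero_of_mul_eq_zero {ρ₀ ρ₁ : Matrix (Fin 2) (Fin 2) ℂ} (h₁ : IsDensity ρ₁)
    (h : ρ₁ * ρ₀ = 0) : ρ₀.det = 0 := by
  by_contra hd
  have : ρ₁ = 0 := by
    calc ρ₁ = ρ₁ * (ρ₀ * ρ₀⁻¹) := by
          rw [mul_nonsing_inv _ (isUnit_iff_ne_zero.2 hd), Matrix.mul_one]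
      _ = 0 := by rw [← Matrix.mul_assoc, h, Matrix.zero_mul]
  simpa [this] using h₁.2

theorem IsDensity.apply_one_one_eq_zero {ρ : Matrix (Fin 2) (Fin 2) ℂ} (h : IsDensity ρ)
    (h1 : Pr0 ρ = 1) : ρ 1 1 = 0 := by
  have ht := h.2
  rw [trace_fin_two] at ht
  have h00 := Complex.nonneg_iff.1 (h.1.diag_nonneg (i := 0))
  have h11 := Complex.nonneg_iff.1 (h.1.diag_nonneg (i := 1))
  have := congrArg Complex.re ht
  simp only [Complex.add_re, Complex.one_re, Pr0] at this h1
  apply Complex.ext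
  · simp only [Complex.zero_re]; linarith
  · simpa using h11.2.symm

theorem apply_zero_zero_eq_Pr0 {ρ : Matrix (Fin 2) (Fin 2) ℂ} (h : ρ.PosSemidef) :
    ρ 0 0 = Pr0 ρ := by
  have h00 := Complex.nonneg_iff.1 (h.diag_nonneg (i := 0))
  apply Complex.ext
  · simp [Pr0]
  · simpa using h00.2.symm

theorem Pr0_conjBy_ketbra_zero (U : Matrix (Fin 2) (Fin 2) ℂ) :
    Pr0 (conjBy U (ketbra 0)) = Complex.normSq (U 0 0) := by
  simp [Pr0, conjBy_apply, ketbra, Matrix.mul_apply, Fin.sum_univ_two, Complex.normSq_apply]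

/-! ### Matrices in `SU(2)` and pure states -/

/-- The matrix with first column `(a, b)` that lies in `SU(2)` when `|a|² + |b|² = 1`. -/
def su (a b : ℂ) : Matrix (Fin 2) (Fin 2) ℂ := !![a, -star b; b, star a]

theorem su_conjTranspose_mul {a b : ℂ} (h : a * star a + b * star b = 1) :
    (su a b)ᴴ * su a b = 1 := by
  ext i j
  fin_cases i <;> fin_cases j <;>
    simp [su, Matrix.mul_apply, Fin.sum_univ_two] <;> simp at h
  · linear_combination h
  · ring
  · ring
  · linear_combination h

theorem su_mul_diag (a b d : ℂ) : su a b * su d 0 = su (a * d) (b * d) := by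
  ext i j
  fin_cases i <;> fin_cases j <;> simp [su, Matrix.mul_apply, Fin.sum_univ_two]

/-- A density matrix of determinant `0` is pure. Its entry at `0 0` is assumed nonzero so that the
state vector is a multiple of the first column. -/
theorem IsDensity.exists_su_of_det_eq_zero {ρ : Matrix (Fin 2) (Fin 2) ℂ} (h : IsDensity ρ)
    (hd : ρ.det = 0) (h0 : ρ 0 0 ≠ 0) :
    ∃ a b : ℂ, a * star a + b * star b = 1 ∧ conjBy (su a b) (ketbra 0) = ρ := by
  have hp : 0 < Pr0 ρ := by
    refine lt_of_le_of_ne (Complex.nonneg_iff.1 (h.1.diag_nonneg (i := 0))).1 fun e => h0 ?_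
    rw [apply_zero_zero_eq_Pr0 h.1, ← e, Complex.ofReal_zero]
  have e01 : ρ 0 1 = star (ρ 1 0) := (h.1.1.apply 0 1).symm
  have ht := h.2
  rw [trace_fin_two] at ht
  rw [det_fin_two, e01] at hd
  set r : ℂ := (Real.sqrt (Pr0 ρ) : ℂ) with hr
  have hrr : r * r = ρ 0 0 := by
    rw [hr, apply_zero_zero_eq_Pr0 h.1, ← Complex.ofReal_mul, Real.mul_self_sqrt hp.le]
  have hr0 : r ≠ 0 := by
    intro e
    exact h0 (by rw [← hrr, e, mul_zero])
  have hrs : star r = r := Complex.conj_ofReal _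
  have hb : ρ 1 0 / r * star (ρ 1 0 / r) = ρ 1 1 := by
    rw [star_div₀, hrs, div_mul_div_comm, hrr, div_eq_iff h0]
    linear_combination -hd
  refine ⟨r, ρ 1 0 / r, by rw [hrs, hrr, hb, ht], ?_⟩
  ext i j
  fin_cases i <;> fin_cases j <;>
    simp only [su, conjBy_apply, ketbra, Matrix.mul_apply, Fin.sum_univ_two, conjTranspose_apply] <;>
    simp
  · rw [← Complex.star_def, hrs, hrr]
  · rw [← Complex.star_def, hrs, mul_div_cancel₀ _ hr0]; exact e01.symm
  · rw [← Complex.star_def, hrs, div_mul_cancel₀ _ hr0]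
  · simpa using hb

/-- A CPSO that fixes `|0⟩⟨0|` and `|1⟩⟨1|` only multiplies the coherences by a constant. This is the
step that uses complete positivity and fails for positive superoperators such as transposition:
the diagonal of the Choi matrix vanishes at `(1, 0)` and `(0, 1)`, hence so do these rows and
columns, which leaves `G (|0⟩⟨1|)` a multiple of `|0⟩⟨1|`. -/
theorem IsCPSO.exists_dephasing {G : Superop (Fin 2)} (hG : IsCPSO G)
    (h0 : G (ketbra 0) = ketbra 0) (h1 : G (ketbra 1) = ketbra 1) :
    ∃ c : ℂ, ∀ ρ, G ρ = !![ρ 0 0, c * ρ 0 1; star c * ρ 1 0, ρ 1 1] := by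
  have hC := hG.posSemidef_choi
  have col01 := apply_eq_zero_of_diag_eq_zero hC (j := (0, 1))
    ((congrFun (congrFun h1 0) 0).trans (by simp [ketbra]))
  have col10 := apply_eq_zero_of_diag_eq_zero hC (j := (1, 0))
    ((congrFun (congrFun h0 1) 1).trans (by simp [ketbra]))
  have herm : ∀ i j, G (single 1 0 1) i j = star (G (single 0 1 1) j i) := fun i j =>
    (hC.1.apply (i, 1) (j, 0)).symm
  have r10 : ∀ j, G (single 0 1 1) 1 j = 0 := fun j => by
    have := (hC.1.apply (1, 0) (j, 1)).symm
    rw [col10, star_zero] at this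
    exact this
  have r00 : G (single 0 1 1) 0 0 = 0 := col01 (0, 0)
  refine ⟨G (single 0 1 1) 0 1, fun ρ => ?_⟩
  have eρ : ρ = ρ 0 0 • ketbra 0 + ρ 1 1 • ketbra 1 + ρ 0 1 • single 0 1 1 +
      ρ 1 0 • single 1 0 1 := by
    ext i j
    fin_cases i <;> fin_cases j <;> simp [ketbra]
  conv_lhs => rw [eρ]
  simp only [map_add, map_smul, h0, h1]
  ext i j
  fin_cases i <;> fin_cases j <;> simp [ketbra, herm, r10, r00, mul_comm]

/-- Dephasing by a constant of modulus `1` is a rotation about the `z` axis. -/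
theorem conjBy_su_diag {c d : ℂ} (hd : d * star d = 1) (hc : d * d = c)
    (ρ : Matrix (Fin 2) (Fin 2) ℂ) :
    conjBy (su d 0) ρ = !![ρ 0 0, c * ρ 0 1; star c * ρ 1 0, ρ 1 1] := by
  subst hc
  simp only [Complex.star_def] at hd
  ext i j
  fin_cases i <;> fin_cases j <;>
    simp [su, conjBy_apply, Matrix.mul_apply, Fin.sum_univ_two, vecMul, dotProduct]
  · linear_combination ρ 0 0 * hd
  · ring
  · ring
  · linear_combination ρ 1 1 * hd

theorem exp_mul_star_self (x : ℝ) :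
    Complex.exp (x * Complex.I) * star (Complex.exp (x * Complex.I)) = 1 := by
  rw [Complex.star_def, Complex.mul_conj, Complex.normSq_eq_norm_sq,
    Complex.norm_exp_ofReal_mul_I]
  simp

/-- A complex number of modulus `1` has a square root of modulus `1`. -/
theorem exists_mul_self_eq_of_mul_star_eq_one {c : ℂ} (h : c * star c = 1) :
    ∃ d : ℂ, d * star d = 1 ∧ d * d = c := by
  have hn : ‖c‖ = 1 := by
    have : Complex.normSq c = 1 := by
      rw [Complex.star_def, Complex.mul_conj] at h
      exact_mod_cast h
    rw [Complex.norm_def, this, Real.sqrt_one]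
  refine ⟨Complex.exp ((c.arg / 2 : ℝ) * Complex.I), exp_mul_star_self _, ?_⟩
  rw [← Complex.exp_add]
  have := Complex.norm_mul_exp_arg_mul_I c
  rw [hn, Complex.ofReal_one, one_mul] at this
  conv_rhs => rw [← this]
  congr 1
  push_cast
  ring

/-! ### Classical periodicity forces unitarity -/

/-- If some power `G ^ n`, `n ≥ 2`, of a CPSO fixes both classical states, and `G` sends `|0⟩⟨0|` to a
state that is not classical, then `G` is conjugation by a matrix in `SU(2)`. -/
theorem IsCPSO.exists_su_of_pow {G : Superop (Fin 2)} (hG : IsCPSO G) {n : ℕ} (hn : 2 ≤ n)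
    (e₀ : (G ^ n) (ketbra 0) 1 1 = 0) (e₁ : (G ^ n) (ketbra 1) 0 0 = 0)
    (h₀ : G (ketbra 0) 0 0 ≠ 0) (h₁ : G (ketbra 0) 1 1 ≠ 0) :
    ∃ a b : ℂ, a * star a + b * star b = 1 ∧ G = conjBy (su a b) := by
  obtain ⟨m, rfl⟩ := Nat.exists_eq_add_of_le' hn
  have d₀ := hG.1 _ (isDensity_ketbra 0)
  have d₁ := hG.1 _ (isDensity_ketbra 1)
  -- the remaining iterations of `G` bring these states back to `|0⟩⟨0|` and `|1⟩⟨1|`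
  have orth1 : G (ketbra 1) * G (ketbra 0) = 0 :=
    (hG.pow (m + 1)).mul_eq_zero_of_distinguishes d₀.1 d₁.1 e₀ e₁
  have orth2 : G (G (ketbra 1)) * G (G (ketbra 0)) = 0 :=
    (hG.pow m).mul_eq_zero_of_distinguishes (hG.1 _ d₀).1 (hG.1 _ d₁).1 e₀ e₁
  have det1 := det_eq_zero_of_mul_eq_zero d₁ orth1
  have det2 := det_eq_zero_of_mul_eq_zero (hG.1 _ d₁) orth2
  obtain ⟨a, b, hab, hU⟩ := d₀.exists_su_of_det_eq_zero det1 h₀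
  have hUU := su_conjTranspose_mul hab
  have hUU' := mul_eq_one_comm.1 hUU
  set U := su a b with hUdef
  -- undo the unitary that prepares `G (|0⟩⟨0|)`, so that the rest of `G` fixes both classical states
  let G' := conjBy Uᴴ * G
  have hGG' : G = conjBy U * G' := by
    rw [← mul_assoc, ← conjBy_mul, hUU', conjBy_one, one_mul]
  have hG' : IsCPSO G' := (isCPSO_conjBy (by rwa [conjTranspose_conjTranspose])).mul hG
  have f₀ : G' (ketbra 0) = ketbra 0 := by
    change conjBy Uᴴ (G (ketbra 0)) = _
    rw [← hU, ← Module.End.mul_apply, ← conjBy_mul, hUU, conjBy_one, Module.End.one_apply]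
  have f₁ : G' (ketbra 1) = ketbra 1 := by
    have d := hG'.1 _ (isDensity_ketbra 1)
    have orth : G' (ketbra 1) * ketbra 0 = 0 := by
      have : G' (ketbra 1) * G' (ketbra 0) = 0 := by
        change Uᴴ * G (ketbra 1) * Uᴴᴴ * (Uᴴ * G (ketbra 0) * Uᴴᴴ) = 0
        rw [conjTranspose_conjTranspose]
        calc _ = Uᴴ * (G (ketbra 1) * (U * Uᴴ) * G (ketbra 0)) * U := by
              simp only [Matrix.mul_assoc]
          _ = 0 := by rw [hUU', Matrix.mul_one, orth1, Matrix.mul_zero, Matrix.zero_mul]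
      rwa [f₀] at this
    have c0 : ∀ i, G' (ketbra 1) i 0 = 0 := fun i => by
      simpa [ketbra] using congrFun (congrFun orth i) 0
    have c1 : G' (ketbra 1) 0 1 = 0 := by rw [← d.1.1.apply 0 1, c0, star_zero]
    have ht := d.2
    rw [trace_fin_two, c0, zero_add] at ht
    have e : ketbra 1 = !![0, 0; 0, 1] := by
      ext i j
      fin_cases i <;> fin_cases j <;> simp [ketbra]
    rw [eta_fin_two (G' (ketbra 1)), c0, c0, c1, ht, e]
  obtain ⟨c, hc⟩ := hG'.exists_dephasing f₀ f₁
  -- `G (|0⟩⟨0|)` and `G (G (|0⟩⟨0|))` are both pure, and the former has a nonzero coherence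
  have hcc : c * star c = 1 := by
    have e01 : G (ketbra 0) 0 1 = star (G (ketbra 0) 1 0) := (d₀.1.1.apply 0 1).symm
    have hdet : (G' (G (ketbra 0))).det = 0 := by
      change (Uᴴ * G (G (ketbra 0)) * Uᴴᴴ).det = 0
      rw [det_mul, det_mul, det2]
      ring
    rw [hc, det_fin_two_of] at hdet
    rw [det_fin_two] at det1
    have : (G (ketbra 0) 0 0 * G (ketbra 0) 1 1) * (1 - c * star c) = 0 := by
      linear_combination hdet - c * star c * det1
    rcases mul_eq_zero.1 this with h | h
    · exact absurd h (mul_ne_zero h₀ h₁)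
    · linear_combination -h
  obtain ⟨d, hd, hdc⟩ := exists_mul_self_eq_of_mul_star_eq_one hcc
  refine ⟨a * d, b * d, ?_, ?_⟩
  · simp only [star_mul']
    linear_combination d * star d * hab + hd
  · rw [hGG', ← su_mul_diag, conjBy_mul, ← hUdef]
    congr 1
    ext1 ρ
    rw [hc, conjBy_su_diag hd hdc]

/-! ### The rotations `rot α θ φ` -/

theorem rot_eq (α θ φ : ℝ) :
    rot α θ φ =
      !![Complex.cos (θ / 2) ^ 2 + Complex.exp (α * Complex.I) * Complex.sin (θ / 2) ^ 2,
        Complex.exp (-(φ * Complex.I)) * Complex.sin (θ / 2) * Complex.cos (θ / 2) *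
          (1 - Complex.exp (α * Complex.I));
        Complex.exp (φ * Complex.I) * Complex.sin (θ / 2) * Complex.cos (θ / 2) *
          (1 - Complex.exp (α * Complex.I)),
        Complex.sin (θ / 2) ^ 2 + Complex.exp (α * Complex.I) * Complex.cos (θ / 2) ^ 2] := by
  have hE : Complex.exp (φ * Complex.I) * Complex.exp (-(φ * Complex.I)) = 1 := by
    rw [← Complex.exp_add, add_neg_cancel, Complex.exp_zero]
  have hs : (starRingEnd ℂ) (Complex.exp (φ * Complex.I)) = Complex.exp (-(φ * Complex.I)) := by
    rw [← Complex.exp_conj]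
    simp
  have hsin : (starRingEnd ℂ) (Complex.sin (θ / 2)) = Complex.sin (θ / 2) := by
    simpa using (Complex.conj_ofReal (Real.sin (θ / 2)))
  have hcos : (starRingEnd ℂ) (Complex.cos (θ / 2)) = Complex.cos (θ / 2) := by
    simpa using (Complex.conj_ofReal (Real.cos (θ / 2)))
  ext i j
  fin_cases i <;> fin_cases j <;>
    simp only [rot, Matrix.add_apply, Matrix.smul_apply, vecMulVec_apply] <;>
    simp [psi, psiPerp, hs, hsin, hcos]
  · ring
  · ring
  · ring
  · linear_combination (Complex.sin (θ / 2) ^ 2 +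
      Complex.exp (α * Complex.I) * Complex.cos (θ / 2) ^ 2) * hE

theorem rot_mul (α β θ φ : ℝ) : rot α θ φ * rot β θ φ = rot (α + β) θ φ := by
  have hE : Complex.exp (φ * Complex.I) * Complex.exp (-(φ * Complex.I)) = 1 := by
    rw [← Complex.exp_add, add_neg_cancel, Complex.exp_zero]
  have h := Complex.sin_sq_add_cos_sq ((θ : ℂ) / 2)
  have hab : Complex.exp ((α + β : ℝ) * Complex.I) =
      Complex.exp (α * Complex.I) * Complex.exp (β * Complex.I) := by
    rw [← Complex.exp_add]; push_cast; ring_nf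
  simp only [rot_eq, hab]
  generalize Complex.exp (α * Complex.I) = x
  generalize Complex.exp (β * Complex.I) = y
  generalize Complex.exp (φ * Complex.I) = e at *
  generalize Complex.exp (-(φ * Complex.I)) = f at *
  generalize Complex.sin ((θ : ℂ) / 2) = s at *
  generalize Complex.cos ((θ : ℂ) / 2) = c at *
  ext i j
  fin_cases i <;> fin_cases j <;> simp [Matrix.mul_apply, Fin.sum_univ_two]
  · linear_combination (s ^ 2 * c ^ 2 * (1 - x) * (1 - y)) * hE + (c ^ 2 + x * y * s ^ 2) * h
  · linear_combination (f * s * c * (1 - x * y)) * h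
  · linear_combination (e * s * c * (1 - x * y)) * h
  · linear_combination (s ^ 2 * c ^ 2 * (1 - x) * (1 - y)) * hE + (s ^ 2 + x * y * c ^ 2) * h

theorem rot_eq_one {α : ℝ} (h : Complex.exp (α * Complex.I) = 1) (θ φ : ℝ) :
    rot α θ φ = 1 := by
  rw [rot_eq, h]
  ext i j
  fin_cases i <;> fin_cases j <;> simp

theorem rot_pow (α θ φ : ℝ) (k : ℕ) : rot α θ φ ^ k = rot (k * α) θ φ := by
  induction k with
  | zero => rw [pow_zero, rot_eq_one (by simp)]
  | succ k ih =>
    rw [pow_succ, ih, rot_mul]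
    congr 1
    push_cast
    ring

/-- The rotation is, up to the phase `exp (iα/2)`, the element of `SU(2)` with the same axis. -/
theorem rot_eq_smul_su (α θ φ : ℝ) :
    rot α θ φ = Complex.exp ((α / 2 : ℝ) * Complex.I) •
      su (Real.cos (α / 2) - Real.sin (α / 2) * Real.cos θ * Complex.I)
        (-(Complex.exp (φ * Complex.I) * Real.sin θ * Real.sin (α / 2) * Complex.I)) := by
  have h := Complex.sin_sq_add_cos_sq ((θ : ℂ) / 2)
  have hw : Complex.exp ((α / 2 : ℝ) * Complex.I) =
      Complex.cos (α / 2) + Complex.sin (α / 2) * Complex.I := by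
    rw [Complex.exp_mul_I]; push_cast; rfl
  have hx : Complex.exp (α * Complex.I) =
      (Complex.cos (α / 2) + Complex.sin (α / 2) * Complex.I) ^ 2 := by
    rw [← hw, ← Complex.exp_nat_mul]; congr 1; push_cast; ring
  have hu := Complex.sin_sq_add_cos_sq ((α : ℂ) / 2)
  have hs : (starRingEnd ℂ) (Complex.exp (φ * Complex.I)) = Complex.exp (-(φ * Complex.I)) := by
    rw [← Complex.exp_conj]
    simp
  have hθs : Complex.sin θ = 2 * Complex.sin (θ / 2) * Complex.cos (θ / 2) := by
    rw [← Complex.sin_two_mul]; ring_nf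
  have hθc : Complex.cos θ = Complex.cos (θ / 2) ^ 2 - Complex.sin (θ / 2) ^ 2 := by
    rw [← Complex.cos_two_mul']; ring_nf
  have ks : (starRingEnd ℂ) (Complex.sin (α / 2)) = Complex.sin (α / 2) := by
    simpa using (Complex.conj_ofReal (Real.sin (α / 2)))
  have kc : (starRingEnd ℂ) (Complex.cos (α / 2)) = Complex.cos (α / 2) := by
    simpa using (Complex.conj_ofReal (Real.cos (α / 2)))
  have ls : (starRingEnd ℂ) (Complex.sin (θ / 2)) = Complex.sin (θ / 2) := by
    simpa using (Complex.conj_ofReal (Real.sin (θ / 2)))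
  have lc : (starRingEnd ℂ) (Complex.cos (θ / 2)) = Complex.cos (θ / 2) := by
    simpa using (Complex.conj_ofReal (Real.cos (θ / 2)))
  rw [rot_eq, hw, hx]
  have hI := Complex.I_sq
  ext i j
  fin_cases i <;> fin_cases j <;> simp [su, hs, hθs, hθc, ks, kc, ls, lc] <;>
  generalize Complex.exp (φ * Complex.I) = e at * <;>
  generalize Complex.exp (-(φ * Complex.I)) = f at * <;>
  generalize Complex.sin ((θ : ℂ) / 2) = s at * <;>
  generalize Complex.cos ((θ : ℂ) / 2) = c at * <;>
  generalize Complex.sin ((α : ℂ) / 2) = S at * <;>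
  generalize Complex.cos ((α : ℂ) / 2) = C at *  <;>
  generalize Complex.I = I at * 
  · linear_combination (C + S * I) * C * h - c ^ 2 * hu + c ^ 2 * S ^ 2 * hI
  · linear_combination (f * s * c) * (-hu) + f * s * c * S ^ 2 * hI
  · linear_combination (e * s * c) * (-hu) + e * s * c * S ^ 2 * hI
  · linear_combination (C + S * I) * C * h - s ^ 2 * hu + s ^ 2 * S ^ 2 * hI

theorem rot_conjTranspose_mul (α θ φ : ℝ) : (rot α θ φ)ᴴ * rot α θ φ = 1 := by
  have h : (rot α θ φ)ᴴ = rot (-α) θ φ := by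
    simp only [rot, conjTranspose_add, conjTranspose_smul, conjTranspose_vecMulVec, star_star,
      Complex.star_def, ← Complex.exp_conj]
    simp
  rw [h, rot_mul, rot_eq_one (by simp)]

theorem zCoord_neg (k : ℕ) (α θ : ℝ) : zCoord k (-α) θ = zCoord k α θ := by
  rw [zCoord, zCoord, mul_neg, Real.cos_neg]

theorem Pr0_conjBy_rot_pow (α θ φ : ℝ) (k : ℕ) :
    Pr0 ((conjBy (rot α θ φ) ^ k) (ketbra 0)) = 1 / 2 + 1 / 2 * zCoord k α θ := by
  have h00 : rot (k * α) θ φ 0 0 = ((Real.cos (θ / 2) ^ 2 + Real.cos (k * α) *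
      Real.sin (θ / 2) ^ 2 : ℝ) : ℂ) + (Real.sin (k * α) * Real.sin (θ / 2) ^ 2 : ℝ) *
      Complex.I := by
    rw [rot_eq, Complex.exp_mul_I]
    simp
    ring
  have hθc : Real.cos θ = Real.cos (θ / 2) ^ 2 - Real.sin (θ / 2) ^ 2 := by
    rw [← Real.cos_two_mul']; ring_nf
  have hθs : Real.sin θ = 2 * Real.sin (θ / 2) * Real.cos (θ / 2) := by
    rw [← Real.sin_two_mul]; ring_nf
  rw [conjBy_pow, rot_pow, Pr0_conjBy_ketbra_zero, h00, Complex.normSq_add_mul_I, zCoord, hθc, hθs]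
  have h := Real.sin_sq_add_cos_sq (θ / 2)
  have hk := Real.sin_sq_add_cos_sq (k * α)
  generalize Real.sin (θ / 2) = s at *
  generalize Real.cos (θ / 2) = c at *
  generalize Real.sin (k * α) = S at *
  generalize Real.cos (k * α) = C at *
  linear_combination s ^ 4 * hk + (1 / 2) * (s ^ 2 + c ^ 2 + 1) * h

theorem Pr0_conjBy_rot_pow_ketbra_one {α θ φ : ℝ} {n : ℕ}
    (hn : Complex.exp ((n * α : ℝ) * Complex.I) = 1) :
    Pr0 ((conjBy (rot α θ φ) ^ n) (ketbra 1)) = 0 := by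
  rw [conjBy_pow, rot_pow, rot_eq_one hn, conjBy_one]
  simp [Pr0, ketbra]

/-! ### Recovering the angles from two measured probabilities -/

theorem exists_conjBy_su_eq_rot {β θ : ℝ} {a b : ℂ} (hre : a.re = Real.cos (β / 2))
    (him : a.im = -(Real.sin (β / 2) * Real.cos θ))
    (hb : Complex.normSq b = (Real.sin θ * Real.sin (β / 2)) ^ 2)
    (h0 : Real.sin θ * Real.sin (β / 2) ≠ 0) :
    ∃ φ ∈ Set.Ico (0 : ℝ) (2 * Real.pi), conjBy (su a b) = conjBy (rot β θ φ) := by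
  set s := Real.sin θ * Real.sin (β / 2) with hs
  have hs0 : (s : ℂ) ≠ 0 := Complex.ofReal_ne_zero.2 h0
  -- `u` is the phase `exp (iφ)` read off from `b = -i exp (iφ) sin θ sin (β/2)`
  let u : ℂ := b * Complex.I / s
  have hu : ‖u‖ = 1 := by
    have : Complex.normSq u = 1 := by
      simp only [u, map_div₀, map_mul, Complex.normSq_I, hb, Complex.normSq_ofReal]
      field_simp
    rw [Complex.norm_def, this, Real.sqrt_one]
  refine ⟨toIcoMod Real.two_pi_pos 0 u.arg, toIcoMod_mem_Ico' _ _, ?_⟩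
  have hexp : Complex.exp ((toIcoMod Real.two_pi_pos 0 u.arg : ℝ) * Complex.I) = u := by
    rw [← self_sub_toIcoDiv_zsmul]
    have h1 := Complex.norm_mul_exp_arg_mul_I u
    rw [hu, Complex.ofReal_one, one_mul] at h1
    conv_rhs => rw [← h1]
    rw [Complex.exp_eq_exp_iff_exists_int]
    refine ⟨-toIcoDiv Real.two_pi_pos 0 u.arg, ?_⟩
    push_cast [zsmul_eq_mul]
    ring
  rw [rot_eq_smul_su, conjBy_smul (exp_mul_star_self _), hexp]
  congr 2
  · apply Complex.ext
    · simp [hre, -Complex.ofReal_cos, -Complex.ofReal_sin]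
    · simp [him, -Complex.ofReal_cos, -Complex.ofReal_sin]
  · have : b = -(u * s * Complex.I) := by
      rw [div_mul_cancel₀ _ hs0, mul_assoc, Complex.I_mul_I]
      ring
    rw [this, hs]
    push_cast
    ring

theorem conjBy_su_neg (a b : ℂ) : conjBy (su (-a) (-b)) = conjBy (su a b) := by
  have : su (-a) (-b) = (-1 : ℂ) • su a b := by
    ext i j
    fin_cases i <;> fin_cases j <;> simp [su]
  rw [this, conjBy_smul (by simp)]

theorem su_sq_apply (a b : ℂ) : (su a b ^ 2) 0 0 = a ^ 2 - Complex.normSq b := by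
  rw [Complex.normSq_eq_conj_mul_self]
  simp [su, sq, Matrix.mul_apply, Fin.sum_univ_two]
  ring

/-- The values for `k = 1` and `k = 2` already determine the rotation up to `φ` and the sign of `α`:
the first fixes `|b|²`, the second fixes `(Re a)²`, and `|a|² + |b|² = 1` then fixes `(Im a)²`. -/
theorem conjBy_su_mem_rotFamily {α θ : ℝ} (hα : α ∈ Set.Ioc 0 Real.pi)
    (hθ : θ ∈ Set.Ioc 0 (Real.pi / 2)) {a b : ℂ} (hab : Complex.normSq a + Complex.normSq b = 1)
    (h1 : Complex.normSq a = 1 / 2 + 1 / 2 * zCoord 1 α θ)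
    (h2 : Complex.normSq ((su a b ^ 2) 0 0) = 1 / 2 + 1 / 2 * zCoord 2 α θ) :
    conjBy (su a b) ∈ rotFamily α θ := by
  -- `-su a b` gives the same superoperator
  wlog hre : 0 ≤ a.re generalizing a b
  · rw [← conjBy_su_neg]
    refine this (by simpa using hab) (by simpa using h1) ?_ (by simp; linarith)
    rw [su_sq_apply] at h2 ⊢
    simpa using h2
  have hS : 0 < Real.sin (α / 2) :=
    Real.sin_pos_of_pos_of_lt_pi (by linarith [hα.1]) (by linarith [hα.2, Real.pi_pos])
  have hC : 0 ≤ Real.cos (α / 2) :=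
    Real.cos_nonneg_of_neg_pi_div_two_le_of_le (by linarith [hα.1, Real.pi_pos])
      (by linarith [hα.2])
  have hs : 0 < Real.sin θ :=
    Real.sin_pos_of_pos_of_lt_pi hθ.1 (by linarith [hθ.2, Real.pi_pos])
  have hSC := Real.sin_sq_add_cos_sq (α / 2)
  have hsc := Real.sin_sq_add_cos_sq θ
  have c1 : Real.cos α = 2 * Real.cos (α / 2) ^ 2 - 1 := by
    rw [← Real.cos_two_mul]; ring_nf
  have c2 : Real.cos (2 * α) = 2 * (2 * Real.cos (α / 2) ^ 2 - 1) ^ 2 - 1 := by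
    rw [Real.cos_two_mul, c1]
  have hb : Complex.normSq b = (Real.sin θ * Real.sin (α / 2)) ^ 2 := by
    rw [zCoord, Nat.cast_one, one_mul, c1] at h1
    linear_combination hab - h1 - (1 / 2) * hsc - Real.sin θ ^ 2 * hSC
  have hre2 : a.re ^ 2 = Real.cos (α / 2) ^ 2 := by
    have key : (4 * (Real.sin θ * Real.sin (α / 2)) ^ 2) *
        (a.re ^ 2 - Real.cos (α / 2) ^ 2) = 0 := by
      have e : Complex.normSq ((su a b ^ 2) 0 0) = (Complex.normSq a + Complex.normSq b) ^ 2 -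
          4 * Complex.normSq b * a.re ^ 2 := by
        rw [su_sq_apply]
        simp only [Complex.normSq_apply, sq, Complex.sub_re, Complex.mul_re, Complex.ofReal_re,
          Complex.sub_im, Complex.mul_im, Complex.ofReal_im]
        ring
      rw [e, hab, hb, zCoord, Nat.cast_ofNat, c2] at h2
      have hS2 : Real.sin (α / 2) ^ 2 = 1 - Real.cos (α / 2) ^ 2 := by linarith
      have hc2 : Real.cos θ ^ 2 = 1 - Real.sin θ ^ 2 := by linarith
      rw [mul_pow, hS2, hc2] at h2
      rw [mul_pow, hS2]
      linear_combination -h2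
    rcases mul_eq_zero.1 key with h | h
    · exact absurd h (by positivity)
    · linarith
  have hre' : a.re = Real.cos (α / 2) := by
    rwa [sq_eq_sq₀ hre hC] at hre2
  have him2 : a.im ^ 2 = (Real.sin (α / 2) * Real.cos θ) ^ 2 := by
    rw [hb, Complex.normSq_apply] at hab
    linear_combination hab - hre2 - hSC - Real.sin (α / 2) ^ 2 * hsc
  rcases sq_eq_sq_iff_eq_or_eq_neg.1 him2 with him | him
  · obtain ⟨φ, hφ, e⟩ := exists_conjBy_su_eq_rot (β := -α) (θ := θ) (a := a) (b := b)
      (by rw [neg_div, Real.cos_neg, hre']) (by rw [neg_div, Real.sin_neg, him]; ring)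
      (by rw [neg_div, Real.sin_neg, hb]; ring)
      (by rw [neg_div, Real.sin_neg]; exact mul_ne_zero hs.ne' (neg_ne_zero.2 hS.ne'))
    exact ⟨φ, hφ, Or.inr e⟩
  · obtain ⟨φ, hφ, e⟩ := exists_conjBy_su_eq_rot hre' him hb (mul_ne_zero hs.ne' hS.ne')
    exact ⟨φ, hφ, Or.inl e⟩

/-! ### The period and the equations -/

theorem period_spec {α : ℝ} (hrat : ∃ q : ℚ, α / Real.pi = q) :
    0 < period α ∧ ∃ m : ℤ, (period α : ℝ) * α = m * (2 * Real.pi) := by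
  refine Nat.sInf_mem (s := {n : ℕ | 0 < n ∧ ∃ m : ℤ, (n : ℝ) * α = m * (2 * Real.pi)}) ?_
  obtain ⟨q, hq⟩ := hrat
  refine ⟨2 * q.den, by have := q.den_pos; omega, q.num, ?_⟩
  have h : (q : ℝ) * q.den = q.num := by exact_mod_cast q.mul_den_eq_num
  rw [div_eq_iff Real.pi_ne_zero] at hq
  push_cast
  rw [hq, ← h]
  ring

theorem two_le_period {α : ℝ} (hα : α ∈ Set.Ioc 0 Real.pi) (hrat : ∃ q : ℚ, α / Real.pi = q) :
    2 ≤ period α := by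
  obtain ⟨hpos, m, hm⟩ := period_spec hrat
  by_contra hlt
  have h1 : period α = 1 := by omega
  rw [h1, Nat.cast_one, one_mul] at hm
  have hp := Real.pi_pos
  have hm0 : (0 : ℝ) < m := by
    by_contra hneg
    nlinarith [hα.1]
  have hm1 : (1 : ℝ) ≤ m := by exact_mod_cast Int.cast_pos.1 hm0
  nlinarith [hα.2]

theorem exp_period {α : ℝ} (hrat : ∃ q : ℚ, α / Real.pi = q) :
    Complex.exp ((period α * α : ℝ) * Complex.I) = 1 := by
  obtain ⟨-, m, hm⟩ := period_spec hrat
  rw [hm, Complex.exp_eq_one_iff]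
  exact ⟨m, by push_cast; ring⟩

theorem zCoord_period {α : ℝ} (hrat : ∃ q : ℚ, α / Real.pi = q) (θ : ℝ) :
    zCoord (period α) α θ = 1 := by
  obtain ⟨-, m, hm⟩ := period_spec hrat
  rw [zCoord, hm, Real.cos_int_mul_two_pi]
  linarith [Real.sin_sq_add_cos_sq θ]

/-- The hypothesis `(α, θ) ≠ (π, π/2)` excludes exactly the case where the rotation swaps the two
classical states. -/
theorem zCoord_one_mem_Ioo {α θ : ℝ} (hα : α ∈ Set.Ioc 0 Real.pi)
    (hθ : θ ∈ Set.Ioc 0 (Real.pi / 2)) (hne : (α, θ) ≠ (Real.pi, Real.pi / 2)) :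
    zCoord 1 α θ ∈ Set.Ioo (-1 : ℝ) 1 := by
  have hp := Real.pi_pos
  have hs : 0 < Real.sin θ := Real.sin_pos_of_pos_of_lt_pi hθ.1 (by linarith [hθ.2])
  have hsc := Real.sin_sq_add_cos_sq θ
  have hc1 : Real.cos α < 1 := by
    rw [← Real.cos_zero]
    exact Real.cos_lt_cos_of_nonneg_of_le_pi le_rfl hα.2 hα.1
  have hs2 : 0 < Real.sin θ ^ 2 := by positivity
  rw [zCoord, Nat.cast_one, one_mul]
  constructor
  · rcases hα.2.lt_or_eq with h | h
    · have : -1 < Real.cos α := by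
        rw [← Real.cos_pi]
        exact Real.cos_lt_cos_of_nonneg_of_le_pi hα.1.le le_rfl h
      nlinarith [sq_nonneg (Real.cos θ)]
    · have hθ' : θ < Real.pi / 2 := lt_of_le_of_ne hθ.2 fun e => hne (by rw [h, e])
      have : 0 < Real.cos θ := Real.cos_pos_of_mem_Ioo ⟨by linarith [hθ.1], hθ'⟩
      nlinarith [sq_pos_of_pos this, Real.neg_one_le_cos α]
  · nlinarith

theorem finite_rotEquations (α θ : ℝ) : (rotEquations α θ).Finite := by
  refine (Set.finite_singleton _).union (((Set.finite_Icc 1 (period α)).image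
    fun k => eqZero k α θ).subset ?_)
  rintro e ⟨k, hk, rfl⟩
  exact ⟨k, hk, rfl⟩

theorem mem_solutions_rotEquations {α θ : ℝ} {G : Superop (Fin 2)} :
    G ∈ solutions (rotEquations α θ) ↔ IsCPSO G ∧ Pr0 ((G ^ period α) (ketbra 1)) = 0 ∧
      ∀ k ∈ Set.Icc 1 (period α), Pr0 ((G ^ k) (ketbra 0)) = 1 / 2 + 1 / 2 * zCoord k α θ := by
  constructor
  · rintro ⟨hG, h⟩
    exact ⟨hG, h _ (Or.inl rfl), fun k hk => h _ (Or.inr ⟨k, hk, rfl⟩)⟩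
  · rintro ⟨hG, h1, h0⟩
    refine ⟨hG, ?_⟩
    rintro e (rfl | ⟨k, hk, rfl⟩)
    · exact h1
    · exact h0 k hk

end SelfTest

theorem theorem1 (α θ : ℝ) (hα : α ∈ Set.Ioc 0 Real.pi) (hθ : θ ∈ Set.Ioc 0 (Real.pi / 2))
    (hne : (α, θ) ≠ (Real.pi, Real.pi / 2)) (hrat : ∃ q : ℚ, α / Real.pi = q) :
    SelfTest.Characterizes (SelfTest.rotEquations α θ) (SelfTest.rotFamily α θ) := by
  open SelfTest in
  refine ⟨finite_rotEquations α θ, Set.Subset.antisymm ?_ ?_⟩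
  · rintro G ⟨φ, -, rfl | rfl⟩ <;> rw [mem_solutions_rotEquations]
    · exact ⟨isCPSO_conjBy (rot_conjTranspose_mul _ _ _),
        Pr0_conjBy_rot_pow_ketbra_one (exp_period hrat),
        fun k _ => Pr0_conjBy_rot_pow α θ φ k⟩
    · refine ⟨isCPSO_conjBy (rot_conjTranspose_mul _ _ _),
        Pr0_conjBy_rot_pow_ketbra_one ?_,
        fun k _ => by rw [Pr0_conjBy_rot_pow, zCoord_neg]⟩
      have := exp_period hrat
      rw [mul_neg, Complex.ofReal_neg, neg_mul, Complex.exp_neg, this, inv_one]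
  · intro G hG
    rw [mem_solutions_rotEquations] at hG
    obtain ⟨hG, hone, hzero⟩ := hG
    have hn := two_le_period hα hrat
    have hz := zCoord_one_mem_Ioo hα hθ hne
    have dens := fun k b => (hG.pow k).1 _ (isDensity_ketbra b)
    have e₀ : (G ^ period α) (ketbra 0) 1 1 = 0 := by
      refine (dens _ 0).apply_one_one_eq_zero ?_
      rw [hzero _ ⟨by omega, le_rfl⟩, zCoord_period hrat]
      norm_num
    have e₁ : (G ^ period α) (ketbra 1) 0 0 = 0 := by
      rw [apply_zero_zero_eq_Pr0 (dens _ 1).1, hone, Complex.ofReal_zero]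
    have hp : Pr0 (G (ketbra 0)) = 1 / 2 + 1 / 2 * zCoord 1 α θ := by
      simpa using hzero 1 ⟨le_rfl, by omega⟩
    have d := hG.1 _ (isDensity_ketbra 0)
    have h₀ : G (ketbra 0) 0 0 ≠ 0 := by
      rw [apply_zero_zero_eq_Pr0 d.1, hp, Complex.ofReal_ne_zero]
      linarith [hz.1]
    have h₁ : G (ketbra 0) 1 1 ≠ 0 := by
      intro h
      have ht := d.2
      rw [Matrix.trace_fin_two, h, add_zero, apply_zero_zero_eq_Pr0 d.1, hp,
        Complex.ofReal_eq_one] at ht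
      linarith [hz.2]
    obtain ⟨a, b, hab, rfl⟩ := hG.exists_su_of_pow hn e₀ e₁ h₀ h₁
    refine conjBy_su_mem_rotFamily hα hθ ?_ ?_ ?_
    · rw [Complex.star_def, Complex.mul_conj, Complex.mul_conj] at hab
      exact_mod_cast hab
    · rw [← hp, Pr0_conjBy_ketbra_zero]
      rfl
    · rw [← hzero 2 ⟨by omega, hn⟩, conjBy_pow, Pr0_conjBy_ketbra_zero]
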